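/- Let $\mathbb{N}=\{0,1,2,\dots\}$ and $\mathbb{B}=\mathbb{N}\cup\{{\geq}d : d\in\mathbb{N}\}$; a number $k\in\mathbb{N}$ *meets* $b\in\mathbb{B}$ if $k=d$ when $b=d\in\mathbb{N}$, and if $k\ge d$ when $b$ is ${\geq}d$. An *$\ell$-type bipartite graph* $G=(U,V,E_1,\dots,E_\ell)$ consists of finite vertex sets $U,V$ and pairwise disjoint sets $E_1,\dots,E_\ell\subseteq U\times V$; $\deg_{E_i}(w)$ denotes the number of $E_i$-edges at the vertex $w$. It is *complete* if $U\times V=E_1\cup\dots\cup E_\ell$. For $C\in\mathbb{B}^{\ell\times m}$ and $D\in\mathbb{B}^{\ell\times n}$, it is *$(C,D)$-biregular of size $(\bar M,\bar N)\in\mathbb{N}^m\times\mathbb{N}^n$* if there are partitions $U=U_1\cup\dots\cup U_m$ and $V=V_1\cup\dots\cup V_n$ (into disjoint, possibly empty parts) with $|U_j|=M_j$ for $1\le j\le m$ and $|V_j|=N_j$ for $1\le j\le n$ such that, for every $1\le i\le\ell$, $\deg_{E_i}(u)$ meets $C_{i,j}$ for all $1\le j\le m$ and $u\in U_j$, and $\deg_{E_i}(v)$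 meets $D_{i,j}$ for all $1\le j\le n$ and $v\in V_j$. A *Presburger formula* is a first-order formula over the structure of the natural numbers with addition and the constants $0,1$. **Theorem.** For all $\ell,m,n\in\mathbb{N}$ and all matrices $C\in\mathbb{B}^{\ell\times m}$ and $D\in\mathbb{B}^{\ell\times n}$ there is a Presburger formula $\textsf{COMP-BiREG}_{C,D}(\bar X,\bar Y)$ with free variables among $\bar X=(X_1,\dots,X_m)$ and $\bar Y=(Y_1,\dots,Y_n)$ such that for every $\bar M\in\mathbb{N}^m$ and $\bar N\in\mathbb{N}^n$: there exists a complete $(C,D)$-biregular $\ell$-type bipartite graph of size $(\bar M,\bar N)$ if and only if $\textsf{COMP-BiREG}_{C,D}(\bar M,\bar N)$ holds. -/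

import Mathlib

/-- A degree specification: an element of `𝔹 = ℕ ∪ {≥0, ≥1, ≥2, …}`. -/
inductive DegreeSpec : Type
  /-- The degree is exactly `d`. -/
  | exact (d : ℕ) : DegreeSpec
  /-- The degree is at least `d`. -/
  | atLeast (d : ℕ) : DegreeSpec

/-- `b.Admits k` means that the number `k` meets the specification `b`. -/
def DegreeSpec.Admits : DegreeSpec → ℕ → Prop
  | .exact d, k => k = d
  | .atLeast d, k => d ≤ k

/-- An `ℓ`-type bipartite graph with sides `U` and `V`: pairwise disjoint sets
`E₁, …, E_ℓ ⊆ U × V` of edges. -/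
structure TypedBipartiteGraph (ℓ : ℕ) (U V : Type*) where
  /-- The set of edges of type `i`. -/
  edges : Fin ℓ → Set (U × V)
  pairwise_disjoint : Pairwise fun i j => Disjoint (edges i) (edges j)

namespace TypedBipartiteGraph

variable {ℓ m n : ℕ} {U V : Type*}

/-- The number of edges of type `i` at a vertex `u` of the left side. -/
noncomputable def leftDegree (G : TypedBipartiteGraph ℓ U V) (i : Fin ℓ) (u : U) : ℕ :=
  {v : V | (u, v) ∈ G.edges i}.ncard

/-- The number of edges of type `i` at a vertex `v` of the right side. -/
noncomputable def rightDegree (G : TypedBipartiteGraph ℓ U V) (i : Fin ℓ) (v : V) : ℕ :=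
  {u : U | (u, v) ∈ G.edges i}.ncard

/-- The graph is complete: `U × V = E₁ ∪ ⋯ ∪ E_ℓ`. -/
def IsComplete (G : TypedBipartiteGraph ℓ U V) : Prop :=
  ⋃ i, G.edges i = Set.univ

/-- The partitions `U = U₁ ∪ ⋯ ∪ U_m` and `V = V₁ ∪ ⋯ ∪ V_n`, given by the functions `p` and `q`
that send a vertex to the index of its part (parts may be empty), witness that `G` is
`(C, D)`-biregular. -/
def IsBiregularWitness (G : TypedBipartiteGraph ℓ U V)
    (C : Matrix (Fin ℓ) (Fin m) DegreeSpec) (D : Matrix (Fin ℓ) (Fin n) DegreeSpec)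
    (p : U → Fin m) (q : V → Fin n) : Prop :=
  (∀ (i : Fin ℓ) (j : Fin m) (u : U), p u = j → (C i j).Admits (G.leftDegree i u)) ∧
  (∀ (i : Fin ℓ) (j : Fin n) (v : V), q v = j → (D i j).Admits (G.rightDegree i v))

/-- `G` is a `(C, D)`-biregular graph of size `(M, N)`: some witnessing partitions have parts of
sizes `M₁, …, M_m` and `N₁, …, N_n`. -/
def IsBiregularOfSize (G : TypedBipartiteGraph ℓ U V)
    (C : Matrix (Fin ℓ) (Fin m) DegreeSpec) (D : Matrix (Fin ℓ) (Fin n) DegreeSpec)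
    (M : Fin m → ℕ) (N : Fin n → ℕ) : Prop :=
  ∃ (p : U → Fin m) (q : V → Fin n), G.IsBiregularWitness C D p q ∧
    (∀ j, {u : U | p u = j}.ncard = M j) ∧ (∀ j, {v : V | q v = j}.ncard = N j)

end TypedBipartiteGraph

/-! A complete typed graph is a coloring of the cells of `U × V`. It suffices that the set of
realizable sizes is semilinear (`isSemilinearSet_colorable`), since semilinear sets are Presburger
definable. Call a color open at a vertex if its specification there is a lower bound, and group
vertices into classes: left and right vertices by their set of open colors, and right vertices by a
positive demand for a given color.

If every class is empty or has at least `L` members, realizability amounts to linear conditions: any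
two vertices on opposite sides share an open color, and the total demand for a color on one side is
at most that on the other whenever no vertex of the other side is open in it. Necessity
(`mem_largeSet_of_colorable`) is a count. For sufficiency (`exists_coloring`), a maximal partial
coloring saturates each color on one side (`exists_saturating`); the remaining deficits are repaired
by edges to vertices open in the missing color, and every other cell gets a color open at both ends.

If some class is nonempty but small, delete one of its vertices. The other side's kinds split
according to the color of the deleted edge, with correspondingly lowered specifications. No class
grows and the small one shrinks, so the sum of the class sizes truncated at `L` drops. Putting the
vertex back preserves semilinearity. As that sum is bounded, finitely many rounds suffice
(`exists_isSemilinearSet_between`). -/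

namespace BipartiteColoring

open Finset

/-! ### Partial edge colorings of a complete bipartite graph -/

section Partial

variable {ι U V α : Type*} [DecidableEq U] [DecidableEq V]

/-- Terms are added on both sides to avoid natural subtraction. -/
theorem card_update_eq [Fintype V] [DecidableEq α] (g : V → α) (v : V) (o c : α) :
    #{y | Function.update g v o y = c} + (if g v = c then 1 else 0) =
      #{y | g y = c} + (if o = c then 1 else 0) := by
  rw [card_filter, card_filter, Fintype.sum_eq_add_sum_compl v,
    Fintype.sum_eq_add_sum_compl (f := fun y => if g y = c then 1 else 0) v]
  have : ∑ y ∈ {v}ᶜ, (if Function.update g v o y = c then 1 else 0) =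
      ∑ y ∈ {v}ᶜ, (if g y = c then 1 else 0) := by
    refine sum_congr rfl fun y hy => ?_
    rw [Function.update_of_ne (by simpa using hy)]
  rw [this, Function.update_self]
  omega

/-- The function `f` of two variables with its value at `(u, v)` replaced by `o`. -/
def setCell (f : U → V → α) (u : U) (v : V) (o : α) : U → V → α :=
  Function.update f u (Function.update (f u) v o)

theorem setCell_apply (f : U → V → α) (u : U) (v : V) (o : α) (x : U) (y : V) :
    setCell f u v o x y = if x = u ∧ y = v then o else f x y := by
  by_cases hx : x = u
  · subst hx
    by_cases hy : y = v <;> simp [setCell, hy]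
  · simp [setCell, hx]

theorem card_row_setCell [Fintype V] [DecidableEq α] (f : U → V → α) (u : U) (v : V) (o c : α)
    (x : U) :
    #{y | setCell f u v o x y = c} + (if x = u ∧ f u v = c then 1 else 0) =
      #{y | f x y = c} + (if x = u ∧ o = c then 1 else 0) := by
  by_cases h : x = u
  · subst h
    simpa [setCell] using card_update_eq (f x) v o c
  · simp [setCell, h]

theorem card_col_setCell [Fintype U] [DecidableEq α] (f : U → V → α) (u : U) (v : V) (o c : α)
    (y : V) :
    #{x | setCell f u v o x y = c} + (if y = v ∧ f u v = c then 1 else 0) =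
      #{x | f x y = c} + (if y = v ∧ o = c then 1 else 0) := by
  have h := card_row_setCell (fun y x => f x y) v u o c y
  have e : ∀ x, setCell (fun y x => f x y) v u o y x = setCell f u v o x y := fun x => by
    rw [setCell_apply, setCell_apply]
    simp only [and_comm]
  simpa only [e] using h

variable [Fintype U] [Fintype V] [DecidableEq ι]

/-- `f'` has one more edge of color `i` at `u` and at `v` than `f`, and otherwise the same
degrees. -/
def Augments (f f' : U → V → Option ι) (u : U) (v : V) (i : ι) : Prop :=
  (∀ x k, #{y | f' x y = some k} = #{y | f x y = some k} + if x = u ∧ k = i then 1 else 0) ∧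
  ∀ y k, #{x | f' x y = some k} = #{x | f x y = some k} + if y = v ∧ k = i then 1 else 0

theorem exists_augments_of_eq_none (f : U → V → Option ι) {u : U} {v : V} (i : ι)
    (h : f u v = none) : ∃ f', Augments f f' u v i := by
  refine ⟨setCell f u v (some i), fun x k => ?_, fun y k => ?_⟩
  · simpa [h, eq_comm] using card_row_setCell f u v (some i) (some k) x
  · simpa [h, eq_comm] using card_col_setCell f u v (some i) (some k) y

/-- Uncolor `(u₂, v₂)` and give its color to `(u, v₂)` and `(u₂, v)`: `u₂` and `v₂` each lose and
regain one edge, so only `u` and `v` gain. -/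
theorem exists_augments_of_swap (f : U → V → Option ι) {u u₂ : U} {v v₂ : V} {i : ι}
    (hv : v ≠ v₂) (h₁ : f u v₂ = none) (h₂ : f u₂ v = none)
    (h₃ : f u₂ v₂ = some i) : ∃ f', Augments f f' u v i := by
  obtain ⟨f₁, hf₁⟩ : ∃ f₁, f₁ = setCell f u₂ v₂ none := ⟨_, rfl⟩
  obtain ⟨f₂, hf₂⟩ : ∃ f₂, f₂ = setCell f₁ u v₂ (some i) := ⟨_, rfl⟩
  have e₁ : f₁ u v₂ = none := by simp [hf₁, setCell_apply, h₁]
  have e₂ : f₂ u₂ v = none := by simp [hf₂, hf₁, setCell_apply, h₂, hv]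
  refine ⟨setCell f₂ u₂ v (some i), fun x k => ?_, fun y k => ?_⟩
  · have a₁ := card_row_setCell f u₂ v₂ none (some k) x
    have a₂ := card_row_setCell f₁ u v₂ (some i) (some k) x
    have a₃ := card_row_setCell f₂ u₂ v (some i) (some k) x
    rw [← hf₁] at a₁
    rw [← hf₂] at a₂
    simp only [h₃, e₁, e₂, reduceCtorEq, and_false, if_false, Option.some.injEq] at a₁ a₂ a₃
    simp only [eq_comm (a := k)]
    omega
  · have a₁ := card_col_setCell f u₂ v₂ none (some k) y
    have a₂ := card_col_setCell f₁ u v₂ (some i) (some k) y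
    have a₃ := card_col_setCell f₂ u₂ v (some i) (some k) y
    rw [← hf₁] at a₁
    rw [← hf₂] at a₂
    simp only [h₃, e₁, e₂, reduceCtorEq, and_false, if_false, Option.some.injEq] at a₁ a₂ a₃
    simp only [eq_comm (a := k)]
    omega

variable [Fintype ι]

theorem card_ne_none_le (g : V → Option ι) {c : ℕ} (h : ∀ i, #{y | g y = some i} ≤ c) :
    #{y | g y ≠ none} ≤ Fintype.card ι * c := by
  have : ({y | g y ≠ none} : Finset V) ⊆ univ.biUnion fun i : ι => {y | g y = some i} := by
    intro y hy
    simp only [mem_filter, mem_univ, true_and, ne_eq, mem_biUnion] at hy ⊢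
    exact Option.ne_none_iff_exists'.1 hy
  refine (card_le_card this).trans (card_biUnion_le.trans ?_)
  simpa using sum_le_sum fun i (_ : i ∈ univ) => h i

/-- A partial coloring whose degrees are bounded by demands `a`, `b`, and such that every color
saturates a side. -/
theorem exists_saturating (a : U → ι → ℕ) (b : V → ι → ℕ) {c L : ℕ}
    (ha : ∀ u i, a u i ≤ c) (hb : ∀ v i, b v i ≤ c)
    (hL : Fintype.card ι * c + Fintype.card ι * c * c < L)
    (hW : ∀ v i, 0 < b v i → L ≤ #{v' | 0 < b v' i}) :
    ∃ f : U → V → Option ι,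
      (∀ u i, #{v | f u v = some i} ≤ a u i) ∧ (∀ v i, #{u | f u v = some i} ≤ b v i) ∧
      ∀ i, (∀ u, #{v | f u v = some i} = a u i) ∨ ∀ v, #{u | f u v = some i} = b v i := by
  -- Take an admissible partial coloring with the most edges; no admissible augmentation of it
  -- exists.
  obtain ⟨f, hf, hmax⟩ := exists_max_image
    ({f | (∀ u i, #{v | f u v = some i} ≤ a u i) ∧ ∀ v i, #{u | f u v = some i} ≤ b v i} :
      Finset (U → V → Option ι)) (fun f => ∑ u, ∑ i, #{v | f u v = some i})
    ⟨fun _ _ => none, by simp⟩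
  simp only [mem_filter, mem_univ, true_and] at hf hmax
  have key : ∀ u v i, #{y | f u y = some i} < a u i → #{x | f x v = some i} < b v i →
      ¬ ∃ f', Augments f f' u v i := by
    rintro u v i hu hv ⟨f', h₁, h₂⟩
    have := hmax f' ⟨fun x k => ?_, fun y k => ?_⟩
    · have e : ∑ x, ∑ k, #{y | f' x y = some k} = ∑ x, ∑ k, #{y | f x y = some k} + 1 := by
        simp only [h₁, sum_add_distrib, ite_and, sum_ite_eq', mem_univ, if_true, sum_const_zero,
          Finset.sum_ite_irrel]
      omega
    · rw [h₁]
      split_ifs with h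
      · obtain ⟨rfl, rfl⟩ := h
        exact hu
      · exact hf.1 x k
    · rw [h₂]
      split_ifs with h
      · obtain ⟨rfl, rfl⟩ := h
        exact hv
      · exact hf.2 y k
  refine ⟨f, hf.1, hf.2, fun i => ?_⟩
  by_contra! hcon
  obtain ⟨⟨u, hu⟩, v, hv⟩ := hcon
  replace hu := lt_of_le_of_ne (hf.1 u i) hu
  replace hv := lt_of_le_of_ne (hf.2 v i) hv
  have hfree : ∀ y, #{x | f x y = some i} < b y i → f u y ≠ none := fun y hy h =>
    key u y i hu hy (exists_augments_of_eq_none f i h)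
  have hNu := card_ne_none_le (f u) fun k => (hf.1 u k).trans (ha u k)
  have hNv := card_ne_none_le (fun x => f x v) fun k => (hf.2 v k).trans (hb v k)
  -- Avoiding `X` ensures that an `i`-neighbor `u₂` of the chosen `v₂` has an empty cell with `v`,
  -- as the swap requires.
  let X : Finset V := ({x | f x v ≠ none} : Finset U).biUnion fun x => {y | f x y = some i}
  have hX : #X ≤ Fintype.card ι * c * c :=
    card_biUnion_le.trans ((sum_le_card_nsmul _ _ c fun x _ => (hf.1 x i).trans (ha x i)).trans
      (Nat.mul_le_mul_right _ hNv))
  -- At least `L` right vertices demand color `i`, more than are excluded. Only the right side needs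
  -- this supply, so demand classes are not tracked on the left.
  obtain ⟨v₂, hv₂, hv₂'⟩ : ∃ v₂ ∈ ({y | 0 < b y i} : Finset V),
      v₂ ∉ ({y | f u y ≠ none} : Finset V) ∪ X := by
    refine exists_mem_notMem_of_card_lt_card ?_
    have := hW v i (by omega)
    have := card_union_le ({y | f u y ≠ none} : Finset V) X
    omega
  simp only [mem_union, not_or, mem_filter, mem_univ, true_and, not_not] at hv₂ hv₂'
  have hsat : #{x | f x v₂ = some i} = b v₂ i :=
    le_antisymm (hf.2 v₂ i) (not_lt.1 fun h => hfree v₂ h hv₂'.1)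
  obtain ⟨u₂, hu₂⟩ : ({x | f x v₂ = some i} : Finset U).Nonempty := card_pos.1 (by omega)
  simp only [mem_filter, mem_univ, true_and] at hu₂
  refine key u v i hu hv (exists_augments_of_swap f ?_ hv₂'.1 ?_ hu₂)
  · rintro rfl
    exact hfree v hv hv₂'.1
  · by_contra h
    exact hv₂'.2 (mem_biUnion.2 ⟨u₂, by simpa using h, by simpa using hu₂⟩)

end Partial

end BipartiteColoring

/-! ### Specifications as a base value and an open flag -/

namespace DegreeSpec

/-- The least number that meets a specification. -/
def base : DegreeSpec → ℕ
  | .exact d => d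
  | .atLeast d => d

/-- Whether a specification is a lower bound. -/
def isOpen : DegreeSpec → Bool
  | .exact _ => false
  | .atLeast _ => true

theorem admits_iff (b : DegreeSpec) (k : ℕ) :
    b.Admits k ↔ b.base ≤ k ∧ (b.isOpen = false → k ≤ b.base) := by
  cases b <;> simp [Admits, base, isOpen]
  omega

end DegreeSpec

namespace BipartiteColoring

open Finset

/-! ### Completing a coloring when all classes are large -/

section Large

variable {ι U V Q Λ : Type*}

/-- Large fibers of a function admit a labeling in which each label occurs often in each fiber. -/
theorem exists_label [Fintype V] [DecidableEq Q] [Fintype Λ] [DecidableEq Λ] [Nonempty Λ]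
    (cls : V → Q) (s : ℕ) (h : ∀ v, Fintype.card Λ * s ≤ #{v' | cls v' = cls v}) :
    ∃ lab : V → Λ, ∀ v l, s ≤ #{v' | cls v' = cls v ∧ lab v' = l} := by
  classical
  rcases isEmpty_or_nonempty V with hV | ⟨⟨v₀⟩⟩
  · exact ⟨isEmptyElim, isEmptyElim⟩
  -- The embedding depends on the fiber only, so that all its members agree on the labels; vertices
  -- outside the image get an arbitrary label.
  have : ∀ q, ∃ e : Λ × Fin s → V, (∃ v, cls v = q) →
      Function.Injective e ∧ ∀ x, cls (e x) = q := by
    intro q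
    by_cases hq : ∃ v, cls v = q
    · obtain ⟨v, rfl⟩ := hq
      obtain ⟨e⟩ := Function.Embedding.nonempty_of_card_le (α := Λ × Fin s)
        (β := {v' // cls v' = cls v}) (by simpa [Fintype.card_subtype] using h v)
      exact ⟨fun x => (e x).1, fun _ =>
        ⟨Subtype.val_injective.comp e.injective, fun x => (e x).2⟩⟩
    · exact ⟨fun _ => v₀, fun h => absurd h hq⟩
  choose e he using this
  refine ⟨fun v => if h : ∃ x, e (cls v) x = v then h.choose.1 else Classical.arbitrary Λ,
    fun v l => ?_⟩
  obtain ⟨hinj, hcls⟩ := he (cls v) ⟨v, rfl⟩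
  have hsub : univ.image (fun k : Fin s => e (cls v) (l, k)) ⊆
      ({v' | cls v' = cls v ∧ (if h : ∃ x, e (cls v') x = v' then h.choose.1 else
        Classical.arbitrary Λ) = l} : Finset V) := by
    intro y hy
    obtain ⟨k, -, rfl⟩ := mem_image.1 hy
    simp only [mem_filter, mem_univ, true_and, hcls]
    have hex : ∃ x, e (cls v) x = e (cls v) (l, k) := ⟨_, rfl⟩
    rw [dif_pos hex, hinj hex.choose_spec]
  refine le_trans ?_ (card_le_card hsub)
  rw [card_image_of_injective _ fun k k' hk => by simpa using hinj hk]
  simp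

/-- The set of colors whose specification is a lower bound. -/
def openSet [Fintype ι] (A : ι → DegreeSpec) : Finset ι := {i | (A i).isOpen = true}

theorem mem_openSet [Fintype ι] {A : ι → DegreeSpec} {i : ι} :
    i ∈ openSet A ↔ (A i).isOpen = true := by
  simp [openSet]

/-- Every label occurs at least `s` times among the vertices with the same open set as `v`, all open
in `i`; at most `t` of them have a colored cell, leaving at least `d`. -/
theorem exists_hubs [Fintype ι] [DecidableEq ι] [Fintype V] [DecidableEq Λ]
    {B : V → ι → DegreeSpec} {lab : V → Λ} {s t d : ℕ}
    (hlab : ∀ v l, s ≤ #{v' | openSet (B v') = openSet (B v) ∧ lab v' = l})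
    (g : V → Option ι) (hg : #{v | g v ≠ none} ≤ t) (hd : d + t ≤ s) {v : V} {i : ι}
    (hv : (B v i).isOpen = true) (l : Λ) :
    ∃ S : Finset V, #S = d ∧ ∀ v ∈ S, (B v i).isOpen = true ∧ lab v = l ∧ g v = none := by
  classical
  obtain ⟨S, hS, rfl⟩ := exists_subset_card_eq (n := d)
    (s := ({v' | openSet (B v') = openSet (B v) ∧ lab v' = l} : Finset V) \
      ({v | g v ≠ none} : Finset V)) (by
        have := hlab v l
        have := le_card_sdiff ({v | g v ≠ none} : Finset V)
          ({v' | openSet (B v') = openSet (B v) ∧ lab v' = l} : Finset V)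
        omega)
  refine ⟨S, rfl, fun v' hv' => ?_⟩
  have := hS hv'
  simp only [mem_sdiff, mem_filter, mem_univ, true_and, not_not] at this
  exact ⟨by rwa [← mem_openSet, this.1.1, mem_openSet], this.1.2, this.2⟩

/-- The `i`-cells of `g` together with `S` number exactly `b.base`; further `i`-cells can appear
only when `b` is open. -/
theorem admits_card_of_subset [DecidableEq ι] [Fintype V] (b : DegreeSpec) (i : ι) (col : V → ι)
    (g : V → Option ι) (S : Finset V) (hS : ∀ v ∈ S, g v = none) (hg : #{v | g v = some i} ≤ b.base)
    (hcard : #S = b.base - #{v | g v = some i})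
    (h₁ : ∀ v, g v = some i → col v = i) (h₂ : ∀ v ∈ S, col v = i)
    (h₃ : b.isOpen = false → ∀ v, col v = i → g v = some i ∨ v ∈ S) :
    b.Admits #{v | col v = i} := by
  classical
  have hdisj : Disjoint ({v | g v = some i} : Finset V) S := by
    rw [disjoint_left]
    intro v hv hvS
    simp [hS v hvS] at hv
  have hU : #(({v | g v = some i} : Finset V) ∪ S) = b.base := by
    rw [card_union_of_disjoint hdisj]
    omega
  rw [DegreeSpec.admits_iff, ← hU]
  refine ⟨card_le_card fun v hv => ?_, fun hb => card_le_card fun v hv => ?_⟩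
  · simp only [mem_union, mem_filter, mem_univ, true_and] at hv ⊢
    exact hv.elim (h₁ v) (h₂ v)
  · simp only [mem_union, mem_filter, mem_univ, true_and] at hv ⊢
    exact h₃ hb v hv

/-- If all classes of vertices with the same open colors are large, then the evident necessary
conditions suffice for the existence of a coloring with prescribed degrees. -/
theorem exists_coloring [Fintype ι] [DecidableEq ι] [Fintype U] [Fintype V]
    (A : U → ι → DegreeSpec) (B : V → ι → DegreeSpec) {c L : ℕ}
    (hA : ∀ u i, (A u i).base ≤ c) (hB : ∀ v i, (B v i).base ≤ c)
    (hL₁ : Fintype.card ι * c + Fintype.card ι * c * c < L)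
    (hL₂ : Fintype.card ι * 2 * (c + Fintype.card ι * c) ≤ L)
    (hU : ∀ u, L ≤ #{u' | openSet (A u') = openSet (A u)})
    (hV : ∀ v, L ≤ #{v' | openSet (B v') = openSet (B v)})
    (hW : ∀ v i, 0 < (B v i).base → L ≤ #{v' | 0 < (B v' i).base})
    (hAB : ∀ u v, ∃ i, (A u i).isOpen = true ∧ (B v i).isOpen = true)
    (hsum : ∀ i, (∀ v, (B v i).isOpen = false) → ∑ u, (A u i).base ≤ ∑ v, (B v i).base)
    (hsum' : ∀ i, (∀ u, (A u i).isOpen = false) → ∑ v, (B v i).base ≤ ∑ u, (A u i).base) :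
    ∃ col : U → V → ι, (∀ u i, (A u i).Admits #{v | col u v = i}) ∧
      ∀ v i, (B v i).Admits #{u | col u v = i} := by
  classical
  choose dflt hdA hdB using hAB
  rcases isEmpty_or_nonempty ι with hι | hι
  · exact ⟨dflt, fun _ => isEmptyElim, fun _ => isEmptyElim⟩
  obtain ⟨f, hfU, hfV, hsat⟩ := exists_saturating (fun u i => (A u i).base)
    (fun v i => (B v i).base) hA hB hL₁ hW
  have hcomm : ∀ i, ∑ u, #{v | f u v = some i} = ∑ v, #{u | f u v = some i} := fun i => by
    simp only [card_filter]
    exact sum_comm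
  -- The color in a label reserves a vertex for repairs in that color; the Boolean keeps repairs of
  -- left and right vertices from competing for a cell.
  have hcard : Fintype.card (ι × Bool) = Fintype.card ι * 2 := by simp
  obtain ⟨labU, hlabU⟩ := exists_label (Λ := ι × Bool) (fun u => openSet (A u))
    (c + Fintype.card ι * c) fun u => by rw [hcard]; exact hL₂.trans (hU u)
  obtain ⟨labV, hlabV⟩ := exists_label (Λ := ι × Bool) (fun v => openSet (B v))
    (c + Fintype.card ι * c) fun v => by rw [hcard]; exact hL₂.trans (hV v)
  have hS : ∀ u i, ∃ S : Finset V, #S = (A u i).base - #{v | f u v = some i} ∧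
      ∀ v ∈ S, (B v i).isOpen = true ∧ labV v = (i, (labU u).2) ∧ f u v = none := by
    intro u i
    by_cases hv : ∃ v, (B v i).isOpen = true
    · obtain ⟨v, hv⟩ := hv
      refine exists_hubs hlabV (f u)
        (card_ne_none_le (f u) fun k => (hfU u k).trans (hA u k)) ?_ hv _
      have := hA u i
      omega
    · refine ⟨∅, ?_, by simp⟩
      -- With no right vertex open in `i`, no repair is available, but none is needed: if the right
      -- side is the saturated one, the sum condition forces the left side to be saturated too.
      have hle := hsum i fun v => by simpa using fun h => hv ⟨v, h⟩
      have heq : ∀ u, #{v | f u v = some i} = (A u i).base := by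
        rcases hsat i with h | h
        · exact h
        · have h' : ∑ u, #{v | f u v = some i} = ∑ u, (A u i).base :=
            le_antisymm (sum_le_sum fun u _ => hfU u i) (by simpa [hcomm, h] using hle)
          exact fun u => (sum_eq_sum_iff_of_le fun u _ => hfU u i).1 h' u (mem_univ u)
      simp [heq u]
  have hT : ∀ v i, ∃ S : Finset U, #S = (B v i).base - #{u | f u v = some i} ∧
      ∀ u ∈ S, (A u i).isOpen = true ∧ labU u = (i, !(labV v).2) ∧ f u v = none := by
    intro v i
    by_cases hu : ∃ u, (A u i).isOpen = true
    · obtain ⟨u, hu⟩ := hu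
      refine exists_hubs hlabU (fun u => f u v)
        (card_ne_none_le (fun u => f u v) fun k => (hfV v k).trans (hB v k)) ?_ hu _
      have := hB v i
      omega
    · refine ⟨∅, ?_, by simp⟩
      have hle := hsum' i fun v => by simpa using fun h => hu ⟨v, h⟩
      have heq : ∀ v, #{u | f u v = some i} = (B v i).base := by
        rcases hsat i with h | h
        · have h' : ∑ v, #{u | f u v = some i} = ∑ v, (B v i).base :=
            le_antisymm (sum_le_sum fun v _ => hfV v i) (by simpa [← hcomm, h] using hle)
          exact fun v => (sum_eq_sum_iff_of_le fun v _ => hfV v i).1 h' v (mem_univ v)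
        · exact h
      simp [heq v]
  choose S hScard hSmem using hS
  choose T hTcard hTmem using hT
  obtain ⟨col, hcol⟩ : ∃ col : U → V → ι, ∀ u v, col u v = (f u v).getD
      (if v ∈ S u (labV v).1 then (labV v).1 else
        if u ∈ T v (labU u).1 then (labU u).1 else dflt u v) := ⟨_, fun _ _ => rfl⟩
  -- Left repairs use equal Booleans at the two ends, right repairs use opposite ones.
  have hST : ∀ u v i k, v ∈ S u i → u ∉ T v k := by
    intro u v i k hv hu
    have h₁ := (hSmem u i v hv).2.1
    have h₂ := (hTmem v k u hu).2.1
    have h₃ := congrArg Prod.snd h₁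
    have h₄ := congrArg Prod.snd h₂
    simp only at h₃ h₄
    rw [h₃] at h₄
    simp at h₄
  have hcolS : ∀ u v i, v ∈ S u i → col u v = i := by
    intro u v i hv
    obtain ⟨-, h₂, h₃⟩ := hSmem u i v hv
    have h₂ : (labV v).1 = i := by rw [h₂]
    simp [hcol, h₃, h₂, hv]
  have hcolT : ∀ u v i, u ∈ T v i → col u v = i := by
    intro u v i hu
    obtain ⟨-, h₂, h₃⟩ := hTmem v i u hu
    have h₂ : (labU u).1 = i := by rw [h₂]
    have h₄ : v ∉ S u (labV v).1 := fun h => hST u v _ _ h hu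
    simp [hcol, h₃, h₂, hu, h₄]
  -- At a left vertex closed in a color, the last two sources cannot produce it, since both use only
  -- colors open there; on the right, the second and fourth are excluded likewise.
  have hcases : ∀ u v, f u v = some (col u v) ∨ v ∈ S u (col u v) ∨ u ∈ T v (col u v) ∨
      col u v = dflt u v := by
    intro u v
    cases hfuv : f u v with
    | some k => simp [hcol, hfuv]
    | none =>
      by_cases h₁ : v ∈ S u (labV v).1
      · exact .inr (.inl (by rwa [hcolS u v _ h₁]))
      · by_cases h₂ : u ∈ T v (labU u).1
        · exact .inr (.inr (.inl (by rwa [hcolT u v _ h₂])))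
        · exact .inr (.inr (.inr (by simp [hcol, hfuv, h₁, h₂])))
  refine ⟨col, fun u i => ?_, fun v i => ?_⟩
  · refine admits_card_of_subset _ i (col u) (f u) (S u i) (fun v hv => (hSmem u i v hv).2.2)
      (hfU u i) (hScard u i) (fun v hv => by simp [hcol, hv]) (fun v hv => hcolS u v i hv) ?_
    rintro hop v rfl
    rcases hcases u v with h | h | h | h
    · exact .inl h
    · exact .inr h
    · simp [(hTmem v _ u h).1] at hop
    · simp [h, hdA] at hop
  · refine admits_card_of_subset _ i (fun u => col u v) (fun u => f u v) (T v i)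
      (fun u hu => (hTmem v i u hu).2.2) (hfV v i) (hTcard v i) (fun u hu => by simp [hcol, hu])
      (fun u hu => hcolT u v i hu) ?_
    rintro hop u rfl
    rcases hcases u v with h | h | h | h
    · exact .inl h
    · simp [(hSmem u _ v h).1] at hop
    · exact .inr h
    · simp [h, hdB] at hop

end Large

/-! ### Closure properties of semilinear sets -/

section Semilinear

variable {M : Type*} [AddCommMonoid M] {p q : M → Prop}

theorem isSemilinearSet_and (hp : IsSemilinearSet {x | p x}) (hq : IsSemilinearSet {x | q x}) :
    IsSemilinearSet {x | p x ∧ q x} :=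
  hp.inter hq

theorem isSemilinearSet_or (hp : IsSemilinearSet {x | p x}) (hq : IsSemilinearSet {x | q x}) :
    IsSemilinearSet {x | p x ∨ q x} :=
  hp.union hq

variable [AddMonoid.FG M]

theorem isSemilinearSet_forall {κ : Type*} [Finite κ] {r : κ → M → Prop}
    (h : ∀ k, IsSemilinearSet {x | r k x}) : IsSemilinearSet {x | ∀ k, r k x} := by
  convert IsSemilinearSet.iInter h
  ext
  simp

theorem isSemilinearSet_imp (hp : IsSemilinearSet {x | p x}) (hq : IsSemilinearSet {x | q x}) :
    IsSemilinearSet {x | p x → q x} := by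
  convert hp.compl.union hq
  ext
  simp [imp_iff_not_or]

theorem isSemilinearSet_const (P : Prop) : IsSemilinearSet {_x : M | P} := by
  by_cases h : P
  · convert IsSemilinearSet.univ (M := M)
    ext
    simp [h]
  · convert IsSemilinearSet.empty (M := M)
    ext
    simp [h]

theorem isSemilinearSet_eq_const (f : M →+ ℕ) (a : ℕ) : IsSemilinearSet {x | f x = a} :=
  (IsSemilinearSet.singleton a).preimage f

theorem isSemilinearSet_le (f g : M →+ ℕ) : IsSemilinearSet {x | f x ≤ g x} := by
  -- The order relation is the image of `(a, b) ↦ (a, a + b)`.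
  convert ((IsSemilinearSet.univ (M := ℕ × ℕ)).image
    ((AddMonoidHom.fst ℕ ℕ).prod (AddMonoidHom.fst ℕ ℕ + AddMonoidHom.snd ℕ ℕ))).preimage
    (f.prod g)
  ext x
  simp [le_iff_exists_add, eq_comm]

theorem isSemilinearSet_const_le (f : M →+ ℕ) (a : ℕ) : IsSemilinearSet {x | a ≤ f x} := by
  convert (IsSemilinearSet.univ (M := ℕ)).vadd a |>.preimage f
  ext x
  simp [Set.mem_vadd_set, le_iff_exists_add, eq_comm]

theorem isSemilinearSet_admits (b : DegreeSpec) (f : M →+ ℕ) :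
    IsSemilinearSet {x | b.Admits (f x)} := by
  cases b with
  | exact d => exact isSemilinearSet_eq_const f d
  | atLeast d => exact isSemilinearSet_const_le f d

end Semilinear

/-! ### Size vectors and linear functionals on them -/

section Counting

variable {σ τ U V : Type*}

/-- The sum of the entries of a vector weighted by `g`. -/
def weight [Fintype σ] (g : σ → ℕ) : (σ → ℕ) →+ ℕ where
  toFun x := ∑ s, x s * g s
  map_zero' := by simp
  map_add' x y := by simp [add_mul, sum_add_distrib]

theorem weight_le_weight [Fintype σ] {g g' : σ → ℕ} (h : g ≤ g') (x : σ → ℕ) :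
    weight g x ≤ weight g' x :=
  sum_le_sum fun s _ => Nat.mul_le_mul_left _ (h s)

theorem exists_of_weight_pos [Fintype σ] {g x : σ → ℕ} (h : 0 < weight g x) :
    ∃ s, 0 < g s ∧ 0 < x s := by
  obtain ⟨s, -, hs⟩ := exists_ne_zero_of_sum_ne_zero (ne_of_gt h)
  exact ⟨s, Nat.pos_of_ne_zero (right_ne_zero_of_mul hs),
    Nat.pos_of_ne_zero (left_ne_zero_of_mul hs)⟩

variable [DecidableEq σ]

theorem weight_single [Fintype σ] (g : σ → ℕ) (s : σ) : weight g (Pi.single s 1) = g s := by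
  simp [weight, Pi.single_apply]

/-- The sizes of the fibers of `p`. -/
def counts [Fintype U] (p : U → σ) : σ → ℕ := ∑ u, Pi.single (p u) 1

theorem counts_apply [Fintype U] (p : U → σ) (s : σ) : counts p s = #{u | p u = s} := by
  simp only [counts, Finset.sum_apply, Pi.single_apply, card_filter, eq_comm]

theorem exists_counts_eq {σ : Type} [Fintype σ] [DecidableEq σ] (M : σ → ℕ) :
    ∃ (U : Type) (_ : Fintype U) (p : U → σ), counts p = M := by
  refine ⟨Σ s, Fin (M s), inferInstance, Sigma.fst, funext fun s => ?_⟩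
  rw [counts_apply, card_filter, Fintype.sum_sigma]
  simp [apply_ite Finset.card]

theorem weight_counts [Fintype σ] [Fintype U] (g : σ → ℕ) (p : U → σ) :
    weight g (counts p) = ∑ u, g (p u) := by
  simp [counts, map_sum, weight_single]

theorem weight_ite_counts [Fintype σ] [Fintype U] (r : σ → Prop) [DecidablePred r] (p : U → σ) :
    weight (fun s => if r s then 1 else 0) (counts p) = #{u | r (p u)} := by
  rw [weight_counts, card_filter]

variable [Fintype τ]

/-- The map on vectors that adds up the entries over the fibers of `f`. -/
def pushforward (f : τ → σ) : (τ → ℕ) →+ (σ → ℕ) where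
  toFun y := ∑ t, y t • Pi.single (f t) 1
  map_zero' := by simp
  map_add' x y := by simp only [Pi.add_apply, add_smul, sum_add_distrib]

theorem weight_pushforward [Fintype σ] (g : σ → ℕ) (f : τ → σ) (y : τ → ℕ) :
    weight g (pushforward f y) = weight (fun t => g (f t)) y := by
  simp only [pushforward, AddMonoidHom.coe_mk, ZeroHom.coe_mk, map_sum, map_nsmul, weight_single]
  simp [weight]

variable [DecidableEq τ]

theorem pushforward_single (f : τ → σ) (t : τ) :
    pushforward f (Pi.single t 1) = Pi.single (f t) 1 := by
  simp [pushforward, Pi.single_apply]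

theorem pushforward_counts [Fintype V] (f : τ → σ) (q : V → τ) :
    pushforward f (counts q) = counts fun v => f (q v) := by
  simp [counts, map_sum, pushforward_single]

end Counting

/-! ### Realizable sizes and the case of large classes -/

section Colorable

variable {ι σ τ : Type} [DecidableEq ι]

section

variable [DecidableEq σ] [DecidableEq τ]

/-- The sizes of the complete edge-colored bipartite graphs with prescribed degrees. -/
def Colorable (C : σ → ι → DegreeSpec) (D : τ → ι → DegreeSpec) : Set ((σ → ℕ) × (τ → ℕ)) :=
  {x | ∃ (U V : Type) (_ : Fintype U) (_ : Fintype V) (p : U → σ) (q : V → τ) (col : U → V → ι),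
    counts p = x.1 ∧ counts q = x.2 ∧ (∀ u i, (C (p u) i).Admits #{v | col u v = i}) ∧
      ∀ v i, (D (q v) i).Admits #{u | col u v = i}}

theorem swap_mem_colorable {C : σ → ι → DegreeSpec} {D : τ → ι → DegreeSpec}
    {x : (σ → ℕ) × (τ → ℕ)} (h : x ∈ Colorable C D) : x.swap ∈ Colorable D C := by
  obtain ⟨U, V, _, _, p, q, col, hp, hq, h₁, h₂⟩ := h
  exact ⟨V, U, _, _, q, p, fun v u => col u v, hq, hp, h₂, h₁⟩

end

variable [Fintype ι] [Fintype σ] [Fintype τ]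

/-- The number of vertices whose set of open colors is a given one on the left, or on the right, or
of the vertices on the right that demand edges of a given color. -/
def classSize (C : σ → ι → DegreeSpec) (D : τ → ι → DegreeSpec) :
    Finset ι ⊕ Finset ι ⊕ ι → (σ → ℕ) × (τ → ℕ) →+ ℕ
  | .inl P => (weight fun s => if openSet (C s) = P then 1 else 0).comp (AddMonoidHom.fst _ _)
  | .inr (.inl P) =>
    (weight fun t => if openSet (D t) = P then 1 else 0).comp (AddMonoidHom.snd _ _)
  | .inr (.inr i) =>
    (weight fun t => if 0 < (D t i).base then 1 else 0).comp (AddMonoidHom.snd _ _)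

/-- The sizes all of whose classes are empty or large and that satisfy the evident necessary
conditions. -/
def LargeSet (C : σ → ι → DegreeSpec) (D : τ → ι → DegreeSpec) (L : ℕ) :
    Set ((σ → ℕ) × (τ → ℕ)) :=
  {x | (∀ k, classSize C D k x = 0 ∨ L ≤ classSize C D k x) ∧
    (∀ P Q : Finset ι, Disjoint P Q →
      classSize C D (.inl P) x = 0 ∨ classSize C D (.inr (.inl Q)) x = 0) ∧
    (∀ i, weight (fun t => if (D t i).isOpen then 1 else 0) x.2 = 0 →
      weight (fun s => (C s i).base) x.1 ≤ weight (fun t => (D t i).base) x.2) ∧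
    ∀ i, weight (fun s => if (C s i).isOpen then 1 else 0) x.1 = 0 →
      weight (fun t => (D t i).base) x.2 ≤ weight (fun s => (C s i).base) x.1}

theorem isSemilinearSet_largeSet (C : σ → ι → DegreeSpec) (D : τ → ι → DegreeSpec) (L : ℕ) :
    IsSemilinearSet (LargeSet C D L) := by
  refine isSemilinearSet_and (isSemilinearSet_forall fun k => isSemilinearSet_or
    (isSemilinearSet_eq_const _ _) (isSemilinearSet_const_le _ _)) (isSemilinearSet_and
    (isSemilinearSet_forall fun P => isSemilinearSet_forall fun Q => isSemilinearSet_imp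
      (isSemilinearSet_const _) (isSemilinearSet_or (isSemilinearSet_eq_const _ _)
      (isSemilinearSet_eq_const _ _))) (isSemilinearSet_and
    (isSemilinearSet_forall fun i => isSemilinearSet_imp
      (isSemilinearSet_eq_const ((weight fun t => if (D t i).isOpen then 1 else 0).comp
        (AddMonoidHom.snd (σ → ℕ) _)) 0)
      (isSemilinearSet_le ((weight fun s => (C s i).base).comp (AddMonoidHom.fst _ (τ → ℕ)))
        ((weight fun t => (D t i).base).comp (AddMonoidHom.snd (σ → ℕ) _))))
    (isSemilinearSet_forall fun i => isSemilinearSet_imp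
      (isSemilinearSet_eq_const ((weight fun s => if (C s i).isOpen then 1 else 0).comp
        (AddMonoidHom.fst _ (τ → ℕ))) 0)
      (isSemilinearSet_le ((weight fun t => (D t i).base).comp (AddMonoidHom.snd (σ → ℕ) _))
        ((weight fun s => (C s i).base).comp (AddMonoidHom.fst _ (τ → ℕ)))))))

variable [DecidableEq σ] [DecidableEq τ]

theorem largeSet_subset_colorable {C : σ → ι → DegreeSpec} {D : τ → ι → DegreeSpec} {c L : ℕ}
    (hC : ∀ s i, (C s i).base ≤ c) (hD : ∀ t i, (D t i).base ≤ c)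
    (hL₁ : Fintype.card ι * c + Fintype.card ι * c * c < L)
    (hL₂ : Fintype.card ι * 2 * (c + Fintype.card ι * c) ≤ L) :
    LargeSet C D L ⊆ Colorable C D := by
  rintro ⟨M, N⟩ ⟨h₁, h₂, h₃, h₄⟩
  obtain ⟨U, _, p, rfl⟩ := exists_counts_eq M
  obtain ⟨V, _, q, rfl⟩ := exists_counts_eq N
  have e₁ : ∀ P, classSize C D (.inl P) (counts p, counts q) = #{u | openSet (C (p u)) = P} :=
    fun P => weight_ite_counts _ p
  have e₂ : ∀ P, classSize C D (.inr (.inl P)) (counts p, counts q) =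
      #{v | openSet (D (q v)) = P} := fun P => weight_ite_counts _ q
  have e₃ : ∀ i, classSize C D (.inr (.inr i)) (counts p, counts q) =
      #{v | 0 < (D (q v) i).base} := fun i => weight_ite_counts _ q
  have hU : ∀ u, #{u' | openSet (C (p u')) = openSet (C (p u))} ≠ 0 := fun u =>
    (card_pos.2 ⟨u, by simp⟩).ne'
  have hV : ∀ v, #{v' | openSet (D (q v')) = openSet (D (q v))} ≠ 0 := fun v =>
    (card_pos.2 ⟨v, by simp⟩).ne'
  refine ⟨U, V, inferInstance, inferInstance, p, q, ?_⟩
  simp only [true_and]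
  refine exists_coloring (fun u => C (p u)) (fun v => D (q v)) (fun u => hC (p u))
    (fun v => hD (q v)) hL₁ hL₂ (fun u => ?_) (fun v => ?_) (fun v i hv => ?_) (fun u v => ?_)
    (fun i hi => ?_) (fun i hi => ?_)
  · exact (e₁ _ ▸ h₁ (.inl _)).resolve_left (hU u)
  · exact (e₂ _ ▸ h₁ (.inr (.inl _))).resolve_left (hV v)
  · exact (e₃ _ ▸ h₁ (.inr (.inr _))).resolve_left (card_pos.2 ⟨v, by simpa using hv⟩).ne'
  · by_contra! hcon
    have := h₂ (openSet (C (p u))) (openSet (D (q v))) (disjoint_left.2 fun i hi hi' =>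
      hcon i (mem_openSet.1 hi) (mem_openSet.1 hi'))
    rw [e₁, e₂] at this
    exact this.elim (hU u) (hV v)
  · have := h₃ i (by simp [weight_counts, hi])
    simpa only [weight_counts] using this
  · have := h₄ i (by simp [weight_counts, hi])
    simpa only [weight_counts] using this

/-- Each closed color is used exactly as often as its base prescribes, hence at most `c` times. -/
theorem card_notMem_openSet_le {V : Type*} [Fintype V] {A : ι → DegreeSpec} {c : ℕ} (g : V → ι)
    (hA : ∀ i, (A i).base ≤ c) (h : ∀ i, (A i).Admits #{v | g v = i}) :
    #{v | g v ∉ openSet A} ≤ Fintype.card ι * c := by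
  classical
  have : ({v | g v ∉ openSet A} : Finset V) ⊆
      ({i | i ∉ openSet A} : Finset ι).biUnion fun i => {v | g v = i} := by
    intro v hv
    simpa using hv
  refine (card_le_card this).trans (card_biUnion_le.trans ?_)
  refine (sum_le_card_nsmul _ _ c fun i hi => ?_).trans
    (Nat.mul_le_mul_right _ (card_le_univ _))
  simp only [mem_filter, mem_univ, true_and, mem_openSet, Bool.not_eq_true] at hi
  exact (((DegreeSpec.admits_iff _ _).1 (h i)).2 hi).trans (hA i)

theorem mem_largeSet_of_colorable {C : σ → ι → DegreeSpec} {D : τ → ι → DegreeSpec} {c L : ℕ}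
    (hC : ∀ s i, (C s i).base ≤ c) (hD : ∀ t i, (D t i).base ≤ c)
    (hL : 2 * (Fintype.card ι * c) < L) {x : (σ → ℕ) × (τ → ℕ)} (hx : x ∈ Colorable C D)
    (h : ∀ k, classSize C D k x = 0 ∨ L ≤ classSize C D k x) : x ∈ LargeSet C D L := by
  obtain ⟨U, V, _, _, p, q, col, hp, hq, hU, hV⟩ := hx
  obtain ⟨M, N⟩ := x
  obtain rfl : counts p = M := hp
  obtain rfl : counts q = N := hq
  have e₁ : ∀ P, classSize C D (.inl P) (counts p, counts q) = #{u | openSet (C (p u)) = P} :=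
    fun P => weight_ite_counts _ p
  have e₂ : ∀ P, classSize C D (.inr (.inl P)) (counts p, counts q) =
      #{v | openSet (D (q v)) = P} := fun P => weight_ite_counts _ q
  have hcomm : ∀ i, ∑ u, #{v | col u v = i} = ∑ v, #{u | col u v = i} := fun i => by
    simp only [card_filter]
    exact sum_comm
  refine ⟨h, fun P Q hPQ => ?_, fun i hi => ?_, fun i hi => ?_⟩
  · classical
    by_contra! hcon
    have hP := (h (.inl P)).resolve_left hcon.1
    have hQ := (h (.inr (.inl Q))).resolve_left hcon.2
    rw [e₁] at hP
    rw [e₂] at hQ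
    set X : Finset U := {u | openSet (C (p u)) = P} with hX
    set Y : Finset V := {v | openSet (D (q v)) = Q} with hY
    -- As `P` and `Q` are disjoint, the color of every cell of `X × Y` is closed at one of its ends.
    have hsub : X ×ˢ Y ⊆ ((X ×ˢ univ).filter fun z => col z.1 z.2 ∉ P) ∪
        ((univ ×ˢ Y).filter fun z => col z.1 z.2 ∉ Q) := by
      rintro ⟨u, v⟩ huv
      have hd : col u v ∉ P ∨ col u v ∉ Q := by
        by_contra! hd
        exact disjoint_left.1 hPQ hd.1 hd.2
      simpa [(mem_product.1 huv).1, (mem_product.1 huv).2] using hd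
    have hcard := (card_le_card hsub).trans (card_union_le _ _)
    rw [card_product, card_filter fun z : U × V => col z.1 z.2 ∉ P,
      card_filter fun z : U × V => col z.1 z.2 ∉ Q, sum_product, sum_product_right] at hcard
    have b₁ := sum_le_card_nsmul X (fun u => ∑ v, if col u v ∉ P then 1 else 0)
      (Fintype.card ι * c) fun u hu => by
        rw [← card_filter, ← (mem_filter.1 hu).2]
        exact card_notMem_openSet_le _ (hC (p u)) (hU u)
    have b₂ := sum_le_card_nsmul Y (fun v => ∑ u, if col u v ∉ Q then 1 else 0)
      (Fintype.card ι * c) fun v hv => by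
        rw [← card_filter, ← (mem_filter.1 hv).2]
        exact card_notMem_openSet_le _ (hD (q v)) (hV v)
    simp only [smul_eq_mul] at b₁ b₂
    -- With `K = Fintype.card ι * c`, the bounds give `#X * #Y ≤ (#X + #Y) * K`, impossible when
    -- both sizes exceed `2 * K`.
    nlinarith
  · simp only [weight_counts, sum_eq_zero_iff, mem_univ, true_imp_iff] at hi ⊢
    calc ∑ u, (C (p u) i).base ≤ ∑ u, #{v | col u v = i} :=
          sum_le_sum fun u _ => ((DegreeSpec.admits_iff _ _).1 (hU u i)).1
      _ = ∑ v, #{u | col u v = i} := hcomm i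
      _ ≤ ∑ v, (D (q v) i).base :=
          sum_le_sum fun v _ => ((DegreeSpec.admits_iff _ _).1 (hV v i)).2 (by simpa using hi v)
  · simp only [weight_counts, sum_eq_zero_iff, mem_univ, true_imp_iff] at hi ⊢
    calc ∑ v, (D (q v) i).base ≤ ∑ v, #{u | col u v = i} :=
          sum_le_sum fun v _ => ((DegreeSpec.admits_iff _ _).1 (hV v i)).1
      _ = ∑ u, #{v | col u v = i} := (hcomm i).symm
      _ ≤ ∑ u, (C (p u) i).base :=
          sum_le_sum fun u _ => ((DegreeSpec.admits_iff _ _).1 (hU u i)).2 (by simpa using hi u)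

end Colorable

end BipartiteColoring

/-! ### Lowering a specification by one edge -/

namespace DegreeSpec

/-- The specification that remains after one edge has been removed. -/
def pred : DegreeSpec → DegreeSpec
  | .exact d => .exact (d - 1)
  | .atLeast d => .atLeast (d - 1)

theorem admits_succ_iff (b : DegreeSpec) (k : ℕ) :
    b.Admits (k + 1) ↔ b ≠ .exact 0 ∧ b.pred.Admits k := by
  cases b with
  | exact d =>
    simp [Admits, pred]
    omega
  | atLeast d => simp [Admits, pred]

theorem base_pred_le (b : DegreeSpec) : b.pred.base ≤ b.base := by
  cases b <;> simp [base, pred]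

theorem isOpen_pred (b : DegreeSpec) : b.pred.isOpen = b.isOpen := by
  cases b <;> rfl

end DegreeSpec

namespace BipartiteColoring

open Finset

/-! ### Removing a vertex and induction on the potential -/

section Removal

variable {ι σ τ : Type} [DecidableEq ι]

/-- The specifications that remain after the removal of a vertex on the other side, where the second
component of the index is the color of the edge to the removed vertex. -/
def residual (D : τ → ι → DegreeSpec) (t : τ × ι) (i : ι) : DegreeSpec :=
  if t.2 = i then (D t.1 i).pred else D t.1 i

theorem base_residual_le (D : τ → ι → DegreeSpec) (t : τ × ι) (i : ι) :
    (residual D t i).base ≤ (D t.1 i).base := by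
  rw [residual]
  split_ifs
  · exact DegreeSpec.base_pred_le _
  · exact le_rfl

variable [Fintype ι]

theorem openSet_residual (D : τ → ι → DegreeSpec) (t : τ × ι) :
    openSet (residual D t) = openSet (D t.1) := by
  ext i
  rw [mem_openSet, mem_openSet, residual]
  split_ifs
  · rw [DegreeSpec.isOpen_pred]
  · rfl

variable [Fintype τ]

/-- The vectors of numbers of vertices of each kind and color of the edge to a vertex that are
compatible with the specifications of this vertex. -/
def CompatibleCounts (c : ι → DegreeSpec) (D : τ → ι → DegreeSpec) : Set (τ × ι → ℕ) :=
  {y | (∀ i, (c i).Admits (weight (fun t => if t.2 = i then 1 else 0) y)) ∧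
    ∀ t, D t.1 t.2 = .exact 0 → y t = 0}

theorem isSemilinearSet_compatibleCounts (c : ι → DegreeSpec) (D : τ → ι → DegreeSpec) :
    IsSemilinearSet (CompatibleCounts c D) :=
  isSemilinearSet_and (isSemilinearSet_forall fun _ => isSemilinearSet_admits _ (weight _))
    (isSemilinearSet_forall fun t => isSemilinearSet_imp (isSemilinearSet_const _)
      (isSemilinearSet_eq_const (Pi.evalAddMonoidHom (fun _ => ℕ) t) 0))

section

variable [Fintype σ]

/-- The sum of the class sizes, truncated at `L`. -/
def potential (C : σ → ι → DegreeSpec) (D : τ → ι → DegreeSpec) (L : ℕ)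
    (x : (σ → ℕ) × (τ → ℕ)) : ℕ :=
  ∑ k, min (classSize C D k x) L

theorem potential_le (C : σ → ι → DegreeSpec) (D : τ → ι → DegreeSpec) (L : ℕ)
    (x : (σ → ℕ) × (τ → ℕ)) :
    potential C D L x ≤ Fintype.card (Finset ι ⊕ Finset ι ⊕ ι) * L :=
  sum_le_card_nsmul _ _ _ fun _ _ => min_le_right _ _

/-- A class below `L` is not affected by the truncation, so its decrease is visible in the sum. -/
theorem potential_lt {σ' τ' : Type} [Fintype σ'] [Fintype τ'] {C : σ → ι → DegreeSpec}
    {D : τ → ι → DegreeSpec} {C' : σ' → ι → DegreeSpec} {D' : τ' → ι → DegreeSpec} {L : ℕ}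
    {x : (σ → ℕ) × (τ → ℕ)} {y : (σ' → ℕ) × (τ' → ℕ)}
    (h : ∀ k, classSize C' D' k y ≤ classSize C D k x) {k : Finset ι ⊕ Finset ι ⊕ ι}
    (hk : classSize C' D' k y < classSize C D k x) (hL : classSize C D k x < L) :
    potential C' D' L y < potential C D L x :=
  sum_lt_sum (fun k _ => min_le_min_right _ (h k)) ⟨k, mem_univ k, by omega⟩

end

variable [DecidableEq σ] [DecidableEq τ]

/-- The new vertex `none` is joined to each right vertex by the color recorded in the second
component of its kind. -/
theorem colorable_of_residual {C : σ → ι → DegreeSpec} {D : τ → ι → DegreeSpec} (s : σ)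
    {y : (σ → ℕ) × (τ × ι → ℕ)} (hy : y ∈ Colorable C (residual D))
    (hs : y.2 ∈ CompatibleCounts (C s) D) :
    (y.1 + Pi.single s 1, pushforward Prod.fst y.2) ∈ Colorable C D := by
  obtain ⟨U, V, _, _, p, q, col, hp, hq, hU, hV⟩ := hy
  rw [← hp, ← hq]
  rw [← hq] at hs
  refine ⟨Option U, V, inferInstance, inferInstance, fun o => o.elim s p, fun v => (q v).1,
    fun o v => o.elim (q v).2 fun u => col u v, ?_, ?_, ?_, ?_⟩
  · simp [counts, Fintype.sum_option, add_comm]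
  · simp [pushforward_counts]
  · rintro (_ | u) i
    · have := hs.1 i
      rwa [weight_ite_counts] at this
    · exact hU u i
  · intro v i
    have h := hV v i
    rw [residual] at h
    change (D (q v).1 i).Admits #{o : Option U | o.elim (q v).2 (fun u => col u v) = i}
    rw [card_filter, Fintype.sum_option]
    change (D (q v).1 i).Admits ((if (q v).2 = i then 1 else 0) + ∑ u, if col u v = i then 1 else 0)
    rw [← card_filter]
    split_ifs at h ⊢ with hi
    · rw [add_comm, DegreeSpec.admits_succ_iff]
      -- Truncated subtraction sends `exact 0` to itself, so the lowered specification alone does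
      -- not forbid the new edge; the second clause of `CompatibleCounts` does.
      refine ⟨fun h0 => ?_, h⟩
      have := hs.2 (q v) (by rw [hi, h0])
      rw [counts_apply, card_eq_zero] at this
      exact notMem_empty v (this ▸ by simp)
    · rwa [zero_add]

theorem exists_residual_of_colorable {C : σ → ι → DegreeSpec} {D : τ → ι → DegreeSpec} {s : σ}
    {x : (σ → ℕ) × (τ → ℕ)} (hx : x ∈ Colorable C D) (hs : 0 < x.1 s) :
    ∃ y ∈ Colorable C (residual D), y.2 ∈ CompatibleCounts (C s) D ∧
      (y.1 + Pi.single s 1, pushforward Prod.fst y.2) = x := by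
  classical
  obtain ⟨U, V, _, _, p, q, col, hp, hq, hU, hV⟩ := hx
  rw [← hp, counts_apply, card_pos] at hs
  obtain ⟨u₀, hu₀⟩ := hs
  obtain rfl : p u₀ = s := by simpa using hu₀
  have hdeg : ∀ v i, #{u | col u v = i} =
      (if col u₀ v = i then 1 else 0) + #{u : {u // u ≠ u₀} | col u v = i} := fun v i => by
    rw [card_filter, card_filter]
    exact Fintype.sum_eq_add_sum_subtype_ne _ _
  refine ⟨(counts fun u : {u // u ≠ u₀} => p u, counts fun v => (q v, col u₀ v)),
    ⟨{u // u ≠ u₀}, V, inferInstance, inferInstance, fun u => p u, fun v => (q v, col u₀ v),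
      fun u v => col u v, rfl, rfl, fun u i => hU u i, fun v i => ?_⟩, ⟨fun i => ?_, fun t ht => ?_⟩,
    Prod.ext ?_ ?_⟩
  · have := hV v i
    rw [hdeg] at this
    rw [residual]
    dsimp only
    split_ifs at this ⊢
    · rw [add_comm, DegreeSpec.admits_succ_iff] at this
      exact this.2
    · rwa [zero_add] at this
  · rw [weight_ite_counts]
    exact hU u₀ i
  · dsimp only
    rw [counts_apply, card_eq_zero, filter_eq_empty_iff]
    rintro v - rfl
    have := hV v (col u₀ v)
    rw [hdeg, if_pos rfl, add_comm, DegreeSpec.admits_succ_iff] at this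
    exact this.1 ht
  · dsimp only
    rw [← hp, counts, counts, Fintype.sum_eq_add_sum_subtype_ne _ u₀, add_comm]
  · dsimp only
    rw [← hq, pushforward_counts]

variable [Fintype σ]

/-- The result of adding a left vertex of kind `s` to the elements of `T`. -/
def addVertex (C : σ → ι → DegreeSpec) (D : τ → ι → DegreeSpec)
    (T : Set ((σ → ℕ) × (τ × ι → ℕ))) (s : σ) : Set ((σ → ℕ) × (τ → ℕ)) :=
  (fun y => (y.1 + Pi.single s 1, pushforward Prod.fst y.2)) ''
    (T ∩ {y | y.2 ∈ CompatibleCounts (C s) D})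

theorem isSemilinearSet_addVertex (C : σ → ι → DegreeSpec) (D : τ → ι → DegreeSpec)
    {T : Set ((σ → ℕ) × (τ × ι → ℕ))} (hT : IsSemilinearSet T) (s : σ) :
    IsSemilinearSet (addVertex C D T s) := by
  have h₁ : IsSemilinearSet (T ∩ {y | y.2 ∈ CompatibleCounts (C s) D}) :=
    hT.inter ((isSemilinearSet_compatibleCounts (C s) D).preimage
      (AddMonoidHom.snd (σ → ℕ) (τ × ι → ℕ)))
  convert (h₁.image ((AddMonoidHom.id (σ → ℕ)).prodMap
    (pushforward (Prod.fst : τ × ι → τ)))).vadd (Pi.single s 1, 0)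
  rw [addVertex, ← Set.image_vadd, Set.image_image]
  exact Set.image_congr fun y _ => Prod.ext (add_comm _ _) (zero_add _).symm

/-- Lowering specifications leaves open sets unchanged and can only reduce positive demands. -/
theorem classSize_residual_right_le (C : σ → ι → DegreeSpec) (D : τ → ι → DegreeSpec) (s : σ)
    (y : (σ → ℕ) × (τ × ι → ℕ)) (k : Finset ι ⊕ Finset ι ⊕ ι) :
    classSize C (residual D) k y ≤
      classSize C D k (y.1 + Pi.single s 1, pushforward Prod.fst y.2) := by
  rcases k with P | P | i
  · simp [classSize]
  · simp [classSize, weight_pushforward, openSet_residual]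
  · simp only [classSize, AddMonoidHom.comp_apply, AddMonoidHom.coe_snd, weight_pushforward]
    refine weight_le_weight (fun t => ?_) _
    have := base_residual_le D t i
    dsimp only
    split_ifs <;> omega

theorem classSize_residual_left_le (C : σ → ι → DegreeSpec) (D : τ → ι → DegreeSpec) (t : τ)
    (y : (σ × ι → ℕ) × (τ → ℕ)) (k : Finset ι ⊕ Finset ι ⊕ ι) :
    classSize (residual C) D k y ≤
      classSize C D k (pushforward Prod.fst y.1, y.2 + Pi.single t 1) := by
  rcases k with P | P | i
  · simp [classSize, weight_pushforward, openSet_residual]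
  · simp [classSize]
  · simp [classSize]

/-- Up to bounded potential, the set of colorable sizes is semilinear. -/
theorem exists_isSemilinearSet_between {c L : ℕ}
    (hL₁ : Fintype.card ι * c + Fintype.card ι * c * c < L)
    (hL₂ : Fintype.card ι * 2 * (c + Fintype.card ι * c) ≤ L)
    (hL₃ : 2 * (Fintype.card ι * c) < L) (k : ℕ) :
    ∀ (σ τ : Type) [Fintype σ] [Fintype τ] [DecidableEq σ] [DecidableEq τ]
      (C : σ → ι → DegreeSpec) (D : τ → ι → DegreeSpec), (∀ s i, (C s i).base ≤ c) →
      (∀ t i, (D t i).base ≤ c) → ∃ T, IsSemilinearSet T ∧ T ⊆ Colorable C D ∧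
        ∀ x ∈ Colorable C D, potential C D L x < k → x ∈ T := by
  induction k with
  | zero => exact fun σ τ _ _ _ _ C D _ _ => ⟨∅, .empty, Set.empty_subset _, by simp⟩
  | succ k ih =>
    intro σ τ _ _ _ _ C D hC hD
    -- The kinds multiply with each removal, so the induction quantifies over all index types; `c`,
    -- and with it `L`, stays fixed because bases never grow.
    obtain ⟨T₁, hT₁, hT₁C, hT₁k⟩ := ih σ (τ × ι) C (residual D) hC
      fun t i => (base_residual_le D t i).trans (hD _ i)
    obtain ⟨T₂, hT₂, hT₂C, hT₂k⟩ := ih (σ × ι) τ (residual C) D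
      (fun s i => (base_residual_le C s i).trans (hC _ i)) hD
    refine ⟨LargeSet C D L ∪ ((⋃ s, addVertex C D T₁ s) ∪
        ⋃ t, Prod.swap '' addVertex D C (Prod.swap '' T₂) t),
      (isSemilinearSet_largeSet C D L).union
        ((IsSemilinearSet.iUnion fun s => isSemilinearSet_addVertex C D hT₁ s).union
          (IsSemilinearSet.iUnion fun t => (isSemilinearSet_addVertex D C
            (hT₂.image (AddEquiv.prodComm : _ ≃+ (τ → ℕ) × (σ × ι → ℕ))) t).image
              (AddEquiv.prodComm : _ ≃+ (σ → ℕ) × (τ → ℕ)))), ?_, ?_⟩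
    · refine Set.union_subset (largeSet_subset_colorable hC hD hL₁ hL₂)
        (Set.union_subset (Set.iUnion_subset fun s => ?_) (Set.iUnion_subset fun t => ?_))
      · rintro _ ⟨y, ⟨hy, hys⟩, rfl⟩
        exact colorable_of_residual s (hT₁C hy) hys
      · rintro _ ⟨_, ⟨_, ⟨⟨y, hy, rfl⟩, hys⟩, rfl⟩, rfl⟩
        exact swap_mem_colorable (colorable_of_residual t (swap_mem_colorable (hT₂C hy)) hys)
    · intro x hx hxk
      have left : ∀ s, 0 < x.1 s →
          (∃ k, classSize C D k x < L ∧ ∀ y, classSize C (residual D) k y <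
            classSize C D k (y.1 + Pi.single s 1, pushforward Prod.fst y.2)) →
          x ∈ ⋃ s, addVertex C D T₁ s := by
        rintro s hs ⟨k', hk', hlt⟩
        obtain ⟨y, hy, hys, rfl⟩ := exists_residual_of_colorable hx hs
        refine Set.mem_iUnion.2 ⟨s, y, ⟨hT₁k y hy ?_, hys⟩, rfl⟩
        have := potential_lt (classSize_residual_right_le C D s y) (hlt y) hk'
        omega
      have right : ∀ t, 0 < x.2 t →
          (∃ k, classSize C D k x < L ∧ ∀ y, classSize (residual C) D k y <
            classSize C D k (pushforward Prod.fst y.1, y.2 + Pi.single t 1)) →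
          x ∈ ⋃ t, Prod.swap '' addVertex D C (Prod.swap '' T₂) t := by
        rintro t ht ⟨k', hk', hlt⟩
        obtain ⟨y, hy, hys, hyx⟩ := exists_residual_of_colorable (swap_mem_colorable hx) ht
        obtain rfl : (pushforward Prod.fst y.2, y.1 + Pi.single t 1) = x := by
          rw [← Prod.swap_swap x, ← hyx, Prod.swap_prod_mk]
        refine Set.mem_iUnion.2 ⟨t, _, ⟨y, ⟨⟨y.swap, hT₂k _ (swap_mem_colorable hy) ?_,
          Prod.swap_swap y⟩, hys⟩, rfl⟩, rfl⟩
        have : potential (residual C) D L y.swap <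
            potential C D L (pushforward Prod.fst y.2, y.1 + Pi.single t 1) :=
          potential_lt (classSize_residual_left_le C D t y.swap) (hlt y.swap) hk'
        omega
      by_cases hsmall : ∀ k, classSize C D k x = 0 ∨ L ≤ classSize C D k x
      · exact .inl (mem_largeSet_of_colorable hC hD hL₃ hx hsmall)
      · push Not at hsmall
        obtain ⟨k', hpos, hlt⟩ := hsmall
        -- Remove a vertex belonging to the small class: a left one for the first kind of class, a
        -- right one for the other two.
        rcases k' with P | P | i
        · obtain ⟨s, hs, hxs⟩ := exists_of_weight_pos (Nat.pos_of_ne_zero hpos)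
          refine .inr (.inl (left s hxs ⟨_, hlt, fun y => ?_⟩))
          simpa [classSize, weight_single] using hs
        · obtain ⟨t, ht, hxt⟩ := exists_of_weight_pos (Nat.pos_of_ne_zero hpos)
          refine .inr (.inr (right t hxt ⟨_, hlt, fun y => ?_⟩))
          simpa [classSize, weight_single] using ht
        · obtain ⟨t, ht, hxt⟩ := exists_of_weight_pos (Nat.pos_of_ne_zero hpos)
          refine .inr (.inr (right t hxt ⟨_, hlt, fun y => ?_⟩))
          simpa [classSize, weight_single] using ht

/-- The set of sizes of complete edge-colored bipartite graphs with prescribed degrees is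
semilinear. -/
theorem isSemilinearSet_colorable (C : σ → ι → DegreeSpec) (D : τ → ι → DegreeSpec) :
    IsSemilinearSet (Colorable C D) := by
  obtain ⟨c, hc⟩ : ∃ c, c = ∑ s, ∑ i, (C s i).base + ∑ t, ∑ i, (D t i).base := ⟨_, rfl⟩
  have hC : ∀ s i, (C s i).base ≤ c := fun s i => by
    have h₁ := single_le_sum_of_canonicallyOrdered (f := fun i => (C s i).base) (mem_univ i)
    have h₂ := single_le_sum_of_canonicallyOrdered (f := fun s => ∑ i, (C s i).base) (mem_univ s)
    omega
  have hD : ∀ t i, (D t i).base ≤ c := fun t i => by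
    have h₁ := single_le_sum_of_canonicallyOrdered (f := fun i => (D t i).base) (mem_univ i)
    have h₂ := single_le_sum_of_canonicallyOrdered (f := fun t => ∑ i, (D t i).base) (mem_univ t)
    omega
  -- The sum of all required thresholds, plus one for the strict inequalities.
  obtain ⟨L, hL⟩ : ∃ L, L = Fintype.card ι * c + Fintype.card ι * c * c +
    Fintype.card ι * 2 * (c + Fintype.card ι * c) + 2 * (Fintype.card ι * c) + 1 := ⟨_, rfl⟩
  -- One more than the maximal potential, so that `T` captures every realizable size.
  obtain ⟨T, hT, hTC, hCT⟩ := exists_isSemilinearSet_between (ι := ι) (c := c) (L := L)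
    (by omega) (by omega) (by omega) (Fintype.card (Finset ι ⊕ Finset ι ⊕ ι) * L + 1)
    σ τ C D hC hD
  rwa [Set.Subset.antisymm (fun x hx => hCT x hx (Nat.lt_succ_of_le (potential_le C D L x))) hTC]

end Removal

end BipartiteColoring

/-! ### From typed graphs to colorings, and to formulas -/

open BipartiteColoring in
theorem mem_colorable_iff {ℓ m n : ℕ} (C : Matrix (Fin ℓ) (Fin m) DegreeSpec)
    (D : Matrix (Fin ℓ) (Fin n) DegreeSpec) (M : Fin m → ℕ) (N : Fin n → ℕ) :
    (∃ (U V : Type) (_ : Finite U) (_ : Finite V) (G : TypedBipartiteGraph ℓ U V),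
      G.IsComplete ∧ G.IsBiregularOfSize C D M N) ↔
    (M, N) ∈ Colorable (fun j i => C i j) (fun j i => D i j) := by
  constructor
  · rintro ⟨U, V, hU, hV, G, hG, p, q, ⟨hC, hD⟩, hM, hN⟩
    have := Fintype.ofFinite U
    have := Fintype.ofFinite V
    have hex : ∀ u v, ∃ i, (u, v) ∈ G.edges i := fun u v => by
      have : (u, v) ∈ ⋃ i, G.edges i := by rw [hG]; trivial
      simpa using this
    choose col hcol using hex
    -- Completeness provides a color for each cell; disjointness makes it unique.
    have hiff : ∀ u v i, (u, v) ∈ G.edges i ↔ col u v = i := fun u v i =>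
      ⟨fun h => by
        by_contra hne
        exact Set.disjoint_left.1 (G.pairwise_disjoint hne) (hcol u v) h, fun h => h ▸ hcol u v⟩
    refine ⟨U, V, inferInstance, inferInstance, p, q, col, funext fun j => ?_, funext fun j => ?_,
      fun u i => ?_, fun v i => ?_⟩
    · rw [counts_apply]
      refine Eq.trans ?_ (hM j)
      rw [← Set.ncard_coe_finset]
      simp
    · rw [counts_apply]
      refine Eq.trans ?_ (hN j)
      rw [← Set.ncard_coe_finset]
      simp
    · convert hC i _ u rfl
      rw [TypedBipartiteGraph.leftDegree, ← Set.ncard_coe_finset]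
      simp [hiff]
    · convert hD i _ v rfl
      rw [TypedBipartiteGraph.rightDegree, ← Set.ncard_coe_finset]
      simp [hiff]
  · rintro ⟨U, V, _, _, p, q, col, hM, hN, hU, hV⟩
    refine ⟨U, V, inferInstance, inferInstance, ⟨fun i => {z | col z.1 z.2 = i}, fun i k hik =>
      Set.disjoint_left.2 fun z hi hk => hik (hi.symm.trans hk)⟩, ?_, p, q, ⟨?_, ?_⟩, ?_, ?_⟩
    · exact Set.eq_univ_of_forall fun z => Set.mem_iUnion.2 ⟨_, rfl⟩
    · rintro i _ u rfl
      convert hU u i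
      rw [TypedBipartiteGraph.leftDegree, ← Set.ncard_coe_finset]
      simp
    · rintro i _ v rfl
      convert hV v i
      rw [TypedBipartiteGraph.rightDegree, ← Set.ncard_coe_finset]
      simp
    · intro j
      refine Eq.trans ?_ (congrFun hM j)
      rw [counts_apply, ← Set.ncard_coe_finset]
      simp
    · intro j
      refine Eq.trans ?_ (congrFun hN j)
      rw [counts_apply, ← Set.ncard_coe_finset]
      simp

/-- Semilinear sets are defined by Presburger formulas without parameters. -/
theorem IsSemilinearSet.exists_formula {α : Type} [Finite α] {s : Set (α → ℕ)}
    (hs : IsSemilinearSet s) :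
    ∃ φ : FirstOrder.Language.presburger.Formula α, ∀ v, v ∈ s ↔ φ.Realize v := by
  obtain ⟨φ, hφ⟩ := Set.empty_definable_iff.1 (hs.definable (A := ∅))
  exact ⟨φ, fun v => by rw [hφ]; rfl⟩

theorem mainTheorem6 (ℓ m n : ℕ)
    (C : Matrix (Fin ℓ) (Fin m) DegreeSpec) (D : Matrix (Fin ℓ) (Fin n) DegreeSpec) :
    ∃ φ : FirstOrder.Language.presburger.Formula (Fin m ⊕ Fin n),
      ∀ (M : Fin m → ℕ) (N : Fin n → ℕ),
        (∃ (U V : Type) (_ : Finite U) (_ : Finite V) (G : TypedBipartiteGraph ℓ U V),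
            G.IsComplete ∧ G.IsBiregularOfSize C D M N) ↔
          φ.Realize (Sum.elim M N : Fin m ⊕ Fin n → ℕ) := by
  obtain ⟨φ, hφ⟩ := ((BipartiteColoring.isSemilinearSet_colorable (fun j i => C i j)
    (fun j i => D i j)).preimage ((LinearMap.funLeft ℕ ℕ Sum.inl).prod
      (LinearMap.funLeft ℕ ℕ Sum.inr) :
      (Fin m ⊕ Fin n → ℕ) →ₗ[ℕ] (Fin m → ℕ) × (Fin n → ℕ))).exists_formula
  refine ⟨φ, fun M N => ?_⟩
  rw [mem_colorable_iff, ← hφ]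
  rfl
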